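/- A depth-$d$ one-dimensional QAC (1D-QAC) circuit on a line of $N$ qubits is a unitary $C = L_d M_d \cdots L_1 M_1 L_0$, where each $L_k$ is a tensor product of $N$ arbitrary single-qubit unitaries and each $M_k$ is a layer of multi-qubit controlled-$Z$ gates acting on pairwise disjoint sets of qubits, each of them a nonempty interval of the line (of any length). The controlled-$Z$ gate on a set $T$ of qubits multiplies a computational basis state by $-1$ if all qubits of $T$ are $1$, and fixes it otherwise. To run the circuit on $x \in \{0,1\}^n$, the bits of $x$ are placed on $n$ distinct, arbitrarily chosen qubits of the line, the other $N-n$ (ancilla) qubits are in an arbitrary fixed pure state $|a\rangle$ independent of $x$, $C$ is applied to $|x\rangle\otimes|a\rangle$, and one fixed qubit is measured in the computational basis; the outcome is denoted $g_C(x) \in \{0,1\}$. Let $\mathrm{Majority}_n(x) = 1$ if $\sum_i x_i \ge n/2$ and $\mathrm{Majority}_n(x) = 0$ otherwise. **Theorem.** There is an absolute constant $c > 0$ such that for all integers $n, d \ge 1$, every number $N$ of qubits, and every depth-$d$ 1D-QAC circuit $C$ on $N$ qubits with $n$ input qubits (with any placement of the inputs, any ancilla state and any output qubit), $$\Pr_{x,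 C}\bigl[g_C(x) = \mathrm{Majority}_n(x)\bigr] \le 1 - c\,\sqrt{\frac1n} + 2\sqrt2\, d\cdot 2^{-n^{1/d}/6},$$ where the probability is over a uniformly random $x \in \{0,1\}^n$ and over the measurement. -/

import Mathlib

namespace OneDimQAC

/-- Computational basis strings of a register of qubits indexed by `ι`. -/
abbrev Bits (ι : Type) : Type := ι → Fin 2

/-- A layer of single-qubit unitaries on a line of `N` qubits (one unitary per qubit). -/
abbrev SingleLayer (N : ℕ) : Type := Fin N → Matrix.unitaryGroup (Fin 2) ℂ

/-- The tensor product of the single-qubit unitaries of a layer, in the computational basis. -/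
noncomputable def SingleLayer.toMatrix {N : ℕ} (L : SingleLayer N) :
    Matrix (Bits (Fin N)) (Bits (Fin N)) ℂ :=
  Matrix.of fun y x => ∏ q : Fin N, (L q : Matrix (Fin 2) (Fin 2) ℂ) (y q) (x q)

/-- A layer of multi-qubit controlled-Z gates on a line of `N` qubits, given by the supports of
its gates.  Each support is a nonempty interval of the line, and distinct gates of the layer act
on disjoint sets of qubits. -/
structure CZLayer (N : ℕ) where
  gates : Finset (Finset (Fin N))
  interval : ∀ T ∈ gates, ∃ a b : Fin N, a ≤ b ∧ T = Finset.Icc a b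
  disjoint : ∀ T ∈ gates, ∀ T' ∈ gates, T ≠ T' → Disjoint T T'

/-- The controlled-Z gate on the qubits in `T` (identity elsewhere): it negates the basis states
that are `1` on all of `T` and fixes all other basis states. -/
def czGate {N : ℕ} (T : Finset (Fin N)) : Matrix (Bits (Fin N)) (Bits (Fin N)) ℂ :=
  Matrix.diagonal fun x => if ∀ q ∈ T, x q = 1 then -1 else 1

/-- The product of the gates of a layer.  The gates are diagonal, so the product is the diagonal
matrix of the products of the diagonal entries. -/
def CZLayer.toMatrix {N : ℕ} (M : CZLayer N) : Matrix (Bits (Fin N)) (Bits (Fin N)) ℂ :=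
  Matrix.diagonal fun x => ∏ T ∈ M.gates, czGate T x x

/-- A one-dimensional QAC circuit `L_d M_d ⋯ L_1 M_1 L_0` of depth `d` on a line of `N` qubits;
the depth is the number of layers of controlled-Z gates. -/
inductive Circuit (N : ℕ) : ℕ → Type
  | base (L : SingleLayer N) : Circuit N 0
  | step {d : ℕ} (C : Circuit N d) (M : CZLayer N) (L : SingleLayer N) : Circuit N (d + 1)

/-- The unitary implemented by a circuit. -/
noncomputable def Circuit.toMatrix {N : ℕ} :
    {d : ℕ} → Circuit N d → Matrix (Bits (Fin N)) (Bits (Fin N)) ℂ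
  | _, .base L => L.toMatrix
  | _, .step C M L => L.toMatrix * M.toMatrix * C.toMatrix

/-- The ancilla qubits, when input bit `i` is placed on qubit `pos i`. -/
abbrev Ancilla {n N : ℕ} (pos : Fin n ↪ Fin N) : Type := {q : Fin N // ∀ i, pos i ≠ q}

/-- The initial state `|x⟩ ⊗ |a⟩`: input bit `i` is on qubit `pos i`, and the ancilla register is
in the state `a`. -/
noncomputable def initialState {n N : ℕ} (pos : Fin n ↪ Fin N)
    (a : EuclideanSpace ℂ (Bits (Ancilla pos))) (x : Bits (Fin n)) : Bits (Fin N) → ℂ :=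
  fun y => if ∀ i, y (pos i) = x i then a (fun q => y q) else 0

/-- The probability that measuring qubit `out` of `C (|x⟩ ⊗ |a⟩)` in the computational basis gives
the outcome `b`. -/
noncomputable def outputProb {n N d : ℕ} (C : Circuit N d) (pos : Fin n ↪ Fin N)
    (a : EuclideanSpace ℂ (Bits (Ancilla pos))) (out : Fin N) (x : Bits (Fin n)) (b : Fin 2) : ℝ :=
  ∑ y : Bits (Fin N) with y out = b, ‖(C.toMatrix.mulVec (initialState pos a x)) y‖ ^ 2

/-- The probability, over a uniformly random input and the final measurement, that the measured
output bit equals `h x`. -/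
noncomputable def successProb {n N d : ℕ} (C : Circuit N d) (pos : Fin n ↪ Fin N)
    (a : EuclideanSpace ℂ (Bits (Ancilla pos))) (out : Fin N) (h : Bits (Fin n) → Fin 2) : ℝ :=
  (∑ x : Bits (Fin n), outputProb C pos a out x (h x)) / 2 ^ n

/-- The majority function: `1` if `∑ x_i ≥ n / 2`, and `0` otherwise. -/
noncomputable def majority (n : ℕ) (x : Bits (Fin n)) : Fin 2 :=
  if (n : ℝ) / 2 ≤ ∑ i, ((x i : ℕ) : ℝ) then 1 else 0

end OneDimQAC

/-!
Delete from the circuit every controlled-Z gate that acts on many input qubits, with a threshold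
that grows geometrically with the layer of the gate. Such a gate is the identity except on the basis
states that are `1` on its whole support; the support contains the light cones of many inputs, and
averaged over these inputs the all-ones states carry exponentially small weight. Hence the deletions
barely change the output. In the remaining circuit light cones grow slowly, since gates act on
intervals with few inputs, so some input on one side of the output qubit cannot influence the
output. Each bit has influence of order `1 / √n` on the majority, and ignoring a bit costs half of
its influence in success probability.
-/

namespace OneDimQAC

open Matrix Set WithLp

section UnitaryMatrix

variable {ι 𝕜 : Type*} [Fintype ι] [RCLike 𝕜]

lemma norm_mulVec_apply_sq_le (A : Matrix ι ι 𝕜) {v : ι → 𝕜} {y : ι} {s t : Finset ι}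
    (hs : ∀ u, v u ≠ 0 → u ∈ s) (ht : ∀ u, A y u ≠ 0 → u ∈ t) :
    ‖(A *ᵥ v) y‖ ^ 2 ≤ (∑ u ∈ s, ‖A y u‖ ^ 2) * ∑ u ∈ t, ‖v u‖ ^ 2 := by
  classical
  have hsupp : (A *ᵥ v) y = ∑ u ∈ s ∩ t, A y u * v u := by
    refine (Finset.sum_subset (Finset.subset_univ _) fun u _ hu => ?_).symm
    by_contra h
    exact hu (Finset.mem_inter.mpr
      ⟨hs u (right_ne_zero_of_mul h), ht u (left_ne_zero_of_mul h)⟩)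
  calc ‖(A *ᵥ v) y‖ ^ 2 ≤ (∑ u ∈ s ∩ t, ‖A y u‖ * ‖v u‖) ^ 2 := by
        rw [hsupp]
        gcongr
        exact (norm_sum_le _ _).trans_eq (Finset.sum_congr rfl fun u _ => norm_mul _ _)
    _ ≤ (∑ u ∈ s ∩ t, ‖A y u‖ ^ 2) * ∑ u ∈ s ∩ t, ‖v u‖ ^ 2 :=
        Finset.sum_mul_sq_le_sq_mul_sq _ _ _
    _ ≤ (∑ u ∈ s, ‖A y u‖ ^ 2) * ∑ u ∈ t, ‖v u‖ ^ 2 := by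
        gcongr
        · exact Finset.inter_subset_left
        · exact Finset.inter_subset_right

lemma sum_norm_sq_eq_norm_indicator_sq (E : Finset ι) (v : ι → 𝕜) :
    ∑ y ∈ E, ‖v y‖ ^ 2 = ‖toLp 2 (indicator (E : Set ι) v)‖ ^ 2 := by
  classical
  rw [EuclideanSpace.norm_sq_eq, ← Finset.sum_subset (Finset.subset_univ E)]
  · exact Finset.sum_congr rfl fun y hy => by simp [hy]
  · intro y _ hy
    simp [hy]

lemma norm_indicator_le (E : Finset ι) (v : ι → 𝕜) :
    ‖toLp 2 (indicator (E : Set ι) v)‖ ≤ ‖toLp 2 v‖ := by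
  refine (sq_le_sq₀ (norm_nonneg _) (norm_nonneg _)).mp ?_
  rw [← sum_norm_sq_eq_norm_indicator_sq, EuclideanSpace.norm_sq_eq]
  exact Finset.sum_le_sum_of_subset_of_nonneg (Finset.subset_univ _) fun _ _ _ => by positivity

lemma sum_norm_sq_le_add_two_mul_norm_sub (E : Finset ι) {u v : ι → 𝕜}
    (hu : ‖toLp 2 u‖ ≤ 1) (hv : ‖toLp 2 v‖ ≤ 1) :
    ∑ y ∈ E, ‖u y‖ ^ 2 ≤ ∑ y ∈ E, ‖v y‖ ^ 2 + 2 * ‖toLp 2 (u - v)‖ := by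
  rw [sum_norm_sq_eq_norm_indicator_sq, sum_norm_sq_eq_norm_indicator_sq]
  have hu' := (norm_indicator_le E u).trans hu
  have hv' := (norm_indicator_le E v).trans hv
  have hsub : ‖toLp 2 (indicator (E : Set ι) u)‖ - ‖toLp 2 (indicator (E : Set ι) v)‖ ≤
      ‖toLp 2 (u - v)‖ := by
    refine (norm_sub_norm_le _ _).trans ?_
    rw [← toLp_sub, ← indicator_sub']
    exact norm_indicator_le E (u - v)
  nlinarith [norm_nonneg (toLp 2 (indicator (E : Set ι) u)),
    norm_nonneg (toLp 2 (indicator (E : Set ι) v)), norm_nonneg (toLp 2 (u - v))]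

variable [DecidableEq ι] {U : Matrix ι ι 𝕜}

lemma norm_mulVec_of_mem_unitaryGroup (hU : U ∈ unitaryGroup ι 𝕜) (v : ι → 𝕜) :
    ‖toLp 2 (U *ᵥ v)‖ = ‖toLp 2 v‖ := by
  rw [← toEuclideanCLM_toLp]
  exact ContinuousLinearMap.norm_map_of_mem_unitary (Unitary.map_mem toEuclideanCLM hU) _

lemma sum_norm_sq_row_of_mem_unitaryGroup (hU : U ∈ unitaryGroup ι 𝕜) (y : ι) :
    ∑ u, ‖U y u‖ ^ 2 = 1 := by
  have h := congrFun (congrFun (mem_unitaryGroup_iff.mp hU) y) y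
  rw [mul_apply, one_apply_eq] at h
  have hcast : ((∑ u, ‖U y u‖ ^ 2 : ℝ) : 𝕜) = 1 := by
    rw [← h]
    push_cast
    exact Finset.sum_congr rfl fun u _ => (RCLike.mul_conj (U y u)).symm
  exact_mod_cast hcast

end UnitaryMatrix

section Locality

variable {ι : Type} {R : Type*}

/-- `A` acts on the qubits in `S` only: it is the tensor product of an operator on `S` with the
identity outside `S`. Since `Fin 2` is a group, this is encoded by saying that the entries of `A`
preserve the bits outside `S` and do not change when both indices are shifted outside `S`. -/
structure IsLocal [Zero R] (S : Set ι) (A : Matrix (Bits ι) (Bits ι) R) : Prop where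
  eqOn_compl : ∀ ⦃y x⦄, A y x ≠ 0 → EqOn y x Sᶜ
  apply_add_add : ∀ ⦃m : Bits ι⦄, EqOn m 0 S → ∀ y x, A (y + m) (x + m) = A y x

namespace IsLocal

variable {S S' : Set ι} {A B : Matrix (Bits ι) (Bits ι) R}

lemma mono [Zero R] (hA : IsLocal S A) (h : S ⊆ S') : IsLocal S' A where
  eqOn_compl _ _ hyx := (hA.eqOn_compl hyx).mono (compl_subset_compl.mpr h)
  apply_add_add _ hm := hA.apply_add_add (hm.mono h)

lemma diagonal [Zero R] [DecidableEq (Bits ι)] {f : Bits ι → R}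
    (hf : ∀ ⦃y x⦄, EqOn y x S → f y = f x) : IsLocal S (Matrix.diagonal f) where
  eqOn_compl y x hyx := by
    obtain rfl : y = x := by_contra fun h => hyx (diagonal_apply_ne _ h)
    exact eqOn_refl _ _
  apply_add_add m hm y x := by
    have hfm : f (y + m) = f y := hf fun q hq => by simp [hm hq]
    simp only [diagonal_apply, add_left_inj, hfm]

variable [Fintype ι] [DecidableEq ι]

lemma mul [NonUnitalNonAssocSemiring R] (hA : IsLocal S A) (hB : IsLocal S B) :
    IsLocal S (A * B) where
  eqOn_compl y x hyx := by
    obtain ⟨w, -, hw⟩ := Finset.exists_ne_zero_of_sum_ne_zero hyx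
    exact (hA.eqOn_compl (left_ne_zero_of_mul hw)).trans
      (hB.eqOn_compl (right_ne_zero_of_mul hw))
  apply_add_add m hm y x := by
    rw [mul_apply, mul_apply, ← Equiv.sum_comp (Equiv.addRight m)]
    exact Finset.sum_congr rfl fun w _ => by
      rw [Equiv.coe_addRight, hA.apply_add_add hm, hB.apply_add_add hm]

/-- The intermediate string `w` of a nonzero term of `B * A` corresponds to the intermediate
string `y + x - w` of a nonzero term of `A * B`. -/
lemma commute_of_disjoint [NonUnitalCommSemiring R] (hA : IsLocal S A) (hB : IsLocal S' B)
    (h : Disjoint S S') : Commute A B := by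
  have hS : S ⊆ S'ᶜ := subset_compl_iff_disjoint_right.mpr h
  have hS' : S' ⊆ Sᶜ := subset_compl_iff_disjoint_left.mpr h
  ext y x
  rw [mul_apply, mul_apply, ← Equiv.sum_comp (Equiv.subLeft (y + x))]
  refine Finset.sum_congr rfl fun w _ => ?_
  rw [Equiv.subLeft_apply]
  by_cases hw : EqOn y w S'ᶜ ∧ EqOn w x Sᶜ
  · obtain ⟨hyw, hwx⟩ := hw
    have hAw := hA.apply_add_add (m := w - y) (fun q hq => by simp [hyw (hS hq)]) y (y + x - w)
    have hBw :=
      hB.apply_add_add (m := w - x) (fun q hq => by simp [hwx (hS' hq)]) (y + x - w) x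
    rw [show y + (w - y) = w by abel, show y + x - w + (w - y) = x by abel] at hAw
    rw [show y + x - w + (w - x) = y by abel, show x + (w - x) = w by abel] at hBw
    rw [← hAw, ← hBw, mul_comm]
  · trans 0
    · by_contra hne
      refine hw ⟨fun q hq => ?_, fun q hq => ?_⟩
      · simpa [sub_eq_iff_eq_add, add_comm (y q)] using
          hB.eqOn_compl (right_ne_zero_of_mul hne) hq
      · simpa [eq_sub_iff_add_eq] using
          hA.eqOn_compl (left_ne_zero_of_mul hne) hq
    · by_contra hne
      exact hw ⟨hB.eqOn_compl (left_ne_zero_of_mul (Ne.symm hne)),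
        hA.eqOn_compl (right_ne_zero_of_mul (Ne.symm hne))⟩

end IsLocal

end Locality

section LightCone

variable {ι : Type} [Fintype ι] [DecidableEq ι] {R : Type*} [CommRing R] [StarRing R]
  {U V : Matrix (Bits ι) (Bits ι) R} {K S T : Set ι}

/-- The light cone of `K` under the unitary `U` lies in `S`: the qubits in `K` influence only those
in `S`. This is encoded by a factorization of `U` into a unitary that does not touch `K`, followed
by one that acts on `S` only. -/
def HasLightCone (U : Matrix (Bits ι) (Bits ι) R) (K S : Set ι) : Prop :=
  K ⊆ S ∧ ∃ A ∈ unitaryGroup (Bits ι) R, ∃ B ∈ unitaryGroup (Bits ι) R,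
    IsLocal S A ∧ IsLocal Kᶜ B ∧ U = A * B

namespace HasLightCone

lemma mono_right (hU : HasLightCone U K S) (h : S ⊆ T) : HasLightCone U K T := by
  obtain ⟨hKS, A, hA, B, hB, hAS, hBK, rfl⟩ := hU
  exact ⟨hKS.trans h, A, hA, B, hB, hAS.mono h, hBK, rfl⟩

lemma mul (hV : HasLightCone V S T) (hU : HasLightCone U K S) : HasLightCone (V * U) K T := by
  obtain ⟨hST, A, hA, B, hB, hAT, hBS, rfl⟩ := hV
  obtain ⟨hKS, A', hA', B', hB', hAS', hBK', rfl⟩ := hU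
  have hcomm : B * A' = A' * B := (hAS'.commute_of_disjoint hBS disjoint_compl_right).symm
  refine ⟨hKS.trans hST, A * A', mul_mem hA hA', B * B', mul_mem hB hB',
    hAT.mul (hAS'.mono hST), (hBS.mono (compl_subset_compl.mpr hKS)).mul hBK', ?_⟩
  rw [mul_assoc, ← mul_assoc B, hcomm, mul_assoc, ← mul_assoc A]

end HasLightCone

end LightCone

section Layers

variable {N : ℕ}

namespace SingleLayer

lemma toMatrix_mul (L L' : SingleLayer N) :
    SingleLayer.toMatrix (L * L') = L.toMatrix * L'.toMatrix := by
  ext y x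
  simp only [toMatrix, mul_apply, of_apply, Pi.mul_apply, UnitaryGroup.mul_apply]
  rw [Finset.prod_univ_sum, Fintype.piFinset_univ]
  exact Finset.sum_congr rfl fun u _ => Finset.prod_mul_distrib

lemma toMatrix_one : SingleLayer.toMatrix (1 : SingleLayer N) = 1 := by
  ext y x
  simp only [toMatrix, of_apply, Pi.one_apply, UnitaryGroup.one_val]
  obtain rfl | h := eq_or_ne y x
  · simp only [one_apply_eq, Finset.prod_const_one]
  · obtain ⟨q, hq⟩ := Function.ne_iff.mp h
    rw [one_apply_ne h]
    exact Finset.prod_eq_zero (Finset.mem_univ q) (one_apply_ne hq)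

lemma star_toMatrix (L : SingleLayer N) : star L.toMatrix = SingleLayer.toMatrix L⁻¹ := by
  ext y x
  simp [toMatrix, Matrix.star_apply, star_prod]

lemma toMatrix_mem_unitaryGroup (L : SingleLayer N) :
    L.toMatrix ∈ unitaryGroup (Bits (Fin N)) ℂ := by
  rw [mem_unitaryGroup_iff, star_toMatrix, ← toMatrix_mul, mul_inv_cancel, toMatrix_one]

lemma isLocal_toMatrix {L : SingleLayer N} {S : Set (Fin N)} (h : ∀ q ∉ S, L q = 1) :
    IsLocal S L.toMatrix where
  eqOn_compl y x hyx q hq := by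
    by_contra hne
    refine hyx (Finset.prod_eq_zero (Finset.mem_univ q) ?_)
    rw [h q hq]
    exact one_apply_ne hne
  apply_add_add m hm y x := by
    simp only [toMatrix, of_apply, Pi.add_apply]
    refine Finset.prod_congr rfl fun q _ => ?_
    by_cases hq : q ∈ S
    · simp [hm hq]
    · simp [h q hq, one_apply]

lemma hasLightCone (L : SingleLayer N) (S : Set (Fin N)) : HasLightCone L.toMatrix S S := by
  refine ⟨subset_rfl, _, toMatrix_mem_unitaryGroup (S.mulIndicator L), _,
    toMatrix_mem_unitaryGroup (Sᶜ.mulIndicator L),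
    isLocal_toMatrix fun q hq => mulIndicator_of_notMem hq L,
    isLocal_toMatrix fun q hq => mulIndicator_of_notMem hq L, ?_⟩
  rw [← toMatrix_mul, mulIndicator_self_mul_compl]

end SingleLayer

namespace CZLayer

lemma eq_of_mem_of_mem (M : CZLayer N) {T T' : Finset (Fin N)} (hT : T ∈ M.gates)
    (hT' : T' ∈ M.gates) {q : Fin N} (hq : q ∈ T) (hq' : q ∈ T') : T = T' :=
  by_contra fun hne => Finset.disjoint_left.mp (M.disjoint T hT T' hT' hne) hq hq'

/-- The diagonal entry of a layer of controlled-Z gates at the basis state `x`. -/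
def phase (M : CZLayer N) (x : Bits (Fin N)) : ℂ := ∏ T ∈ M.gates, czGate T x x

lemma toMatrix_eq_diagonal_phase (M : CZLayer N) : M.toMatrix = diagonal M.phase := rfl

lemma phase_eq_one_or_neg_one (M : CZLayer N) (x : Bits (Fin N)) :
    M.phase x = 1 ∨ M.phase x = -1 := by
  refine Finset.prod_induction _ (fun z : ℂ => z = 1 ∨ z = -1) ?_ (.inl rfl) fun T _ => ?_
  · rintro _ _ (rfl | rfl) (rfl | rfl) <;> simp
  · rw [czGate, diagonal_apply_eq]
    split_ifs <;> simp

lemma toMatrix_mem_unitaryGroup (M : CZLayer N) :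
    M.toMatrix ∈ unitaryGroup (Bits (Fin N)) ℂ := by
  rw [mem_unitaryGroup_iff, toMatrix_eq_diagonal_phase, star_eq_conjTranspose,
    diagonal_conjTranspose, diagonal_mul_diagonal, ← diagonal_one]
  congr 1
  funext x
  rcases M.phase_eq_one_or_neg_one x with h | h <;> simp [h]

/-- The layer that keeps only the gates whose support satisfies `p`. -/
def filter (M : CZLayer N) (p : Finset (Fin N) → Prop) [DecidablePred p] : CZLayer N where
  gates := M.gates.filter p
  interval T hT := M.interval T (Finset.mem_of_mem_filter T hT)
  disjoint T hT T' hT' :=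
    M.disjoint T (Finset.mem_of_mem_filter T hT) T' (Finset.mem_of_mem_filter T' hT')

lemma toMatrix_filter_mul_toMatrix_filter_not (M : CZLayer N) (p : Finset (Fin N) → Prop)
    [DecidablePred p] :
    (M.filter p).toMatrix * (M.filter fun T => ¬ p T).toMatrix = M.toMatrix := by
  simp only [toMatrix_eq_diagonal_phase, diagonal_mul_diagonal]
  congr 1
  funext x
  exact Finset.prod_filter_mul_prod_filter_not _ _ _

lemma isLocal_toMatrix {M : CZLayer N} {S : Set (Fin N)}
    (h : ∀ T ∈ M.gates, (T : Set (Fin N)) ⊆ S) : IsLocal S M.toMatrix := by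
  refine IsLocal.diagonal fun y x hyx => Finset.prod_congr rfl fun T hT => ?_
  have hT : (∀ q ∈ T, y q = 1) ↔ ∀ q ∈ T, x q = 1 :=
    forall₂_congr fun q hq => by rw [hyx (h T hT hq)]
  simp only [czGate, diagonal_apply_eq, hT]

lemma hasLightCone {M : CZLayer N} {S : Set (Fin N)}
    (h : ∀ T ∈ M.gates, (T : Set (Fin N)) ⊆ S ∨ (T : Set (Fin N)) ⊆ Sᶜ) :
    HasLightCone M.toMatrix S S := by
  classical
  refine ⟨subset_rfl, _, toMatrix_mem_unitaryGroup (M.filter fun T => (T : Set (Fin N)) ⊆ S), _,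
    toMatrix_mem_unitaryGroup _, isLocal_toMatrix fun T hT => (Finset.mem_filter.mp hT).2,
    isLocal_toMatrix fun T hT => ?_, (M.toMatrix_filter_mul_toMatrix_filter_not _).symm⟩
  obtain ⟨hT, hTS⟩ := Finset.mem_filter.mp hT
  exact (h T hT).resolve_left hTS

end CZLayer

lemma Circuit.toMatrix_mem_unitaryGroup {d : ℕ} (C : Circuit N d) :
    C.toMatrix ∈ unitaryGroup (Bits (Fin N)) ℂ := by
  induction C with
  | base L => exact L.toMatrix_mem_unitaryGroup
  | step C M L ih =>
    exact mul_mem (mul_mem L.toMatrix_mem_unitaryGroup M.toMatrix_mem_unitaryGroup) ih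

end Layers

section Segments

variable {n N : ℕ}

/-- The interval of the qubits `l, …, r - 1` of the line. -/
def seg (l r : ℕ) : Set (Fin N) := {q | l ≤ (q : ℕ) ∧ (q : ℕ) < r}

@[simp]
lemma mem_seg {l r : ℕ} {q : Fin N} : q ∈ seg l r ↔ l ≤ (q : ℕ) ∧ (q : ℕ) < r := Iff.rfl

lemma seg_self (l : ℕ) : (seg l l : Set (Fin N)) = ∅ :=
  eq_empty_of_forall_notMem fun _ hq => hq.1.not_gt hq.2

lemma seg_subset_seg {l l' r r' : ℕ} (hl : l ≤ l') (hr : r' ≤ r) :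
    (seg l' r' : Set (Fin N)) ⊆ seg l r :=
  fun _ hq => ⟨hl.trans hq.1, hq.2.trans_le hr⟩

lemma seg_val_val_add_one (a b : Fin N) : seg (a : ℕ) (b + 1) = Set.Icc a b := by
  ext q
  rw [mem_seg, Set.mem_Icc, Fin.le_def, Fin.le_def, Nat.lt_add_one_iff]

/-- The number of input bits placed on qubits in `S`. -/
noncomputable def inputCount (pos : Fin n ↪ Fin N) (S : Set (Fin N)) : ℕ := (pos ⁻¹' S).ncard

variable (pos : Fin n ↪ Fin N)

lemma inputCount_empty : inputCount pos ∅ = 0 := by simp [inputCount]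

lemma inputCount_mono {S S' : Set (Fin N)} (h : S ⊆ S') : inputCount pos S ≤ inputCount pos S' :=
  ncard_le_ncard (preimage_mono h)

lemma inputCount_union_le (S S' : Set (Fin N)) :
    inputCount pos (S ∪ S') ≤ inputCount pos S + inputCount pos S' :=
  ncard_union_le (pos ⁻¹' S) (pos ⁻¹' S')

lemma inputCount_seg_le (l l' r' r : ℕ) :
    inputCount pos (seg l r) ≤
      inputCount pos (seg l l') + inputCount pos (seg l' r') + inputCount pos (seg r' r) := by
  have h : (seg l r : Set (Fin N)) ⊆ seg l l' ∪ seg l' r' ∪ seg r' r := by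
    intro q hq
    simp only [mem_union, mem_seg] at hq ⊢
    omega
  calc inputCount pos (seg l r)
      ≤ inputCount pos (seg l l' ∪ seg l' r' ∪ seg r' r) := inputCount_mono pos h
    _ ≤ inputCount pos (seg l l' ∪ seg l' r') + inputCount pos (seg r' r) :=
      inputCount_union_le pos _ _
    _ ≤ _ := by gcongr; exact inputCount_union_le pos _ _

namespace CZLayer

/-- No gate of the layer acts both on a qubit before `c` and on a qubit at or after `c`. -/
def IsCut (M : CZLayer N) (c : ℕ) : Prop :=
  ∀ T ∈ M.gates, (∀ q ∈ T, (q : ℕ) < c) ∨ ∀ q ∈ T, c ≤ (q : ℕ)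

variable {M : CZLayer N}

lemma not_isCut_iff {c : ℕ} :
    ¬ M.IsCut c ↔ ∃ a b : Fin N, Finset.Icc a b ∈ M.gates ∧ (a : ℕ) < c ∧ c ≤ (b : ℕ) := by
  constructor
  · intro h
    simp only [IsCut, not_forall, not_or, not_lt, not_le] at h
    obtain ⟨T, hT, ⟨p, hp, hcp⟩, q, hq, hqc⟩ := h
    obtain ⟨a, b, -, rfl⟩ := M.interval T hT
    exact ⟨a, b, hT, (Fin.le_def.mp (Finset.mem_Icc.mp hq).1).trans_lt hqc,
      hcp.trans (Fin.le_def.mp (Finset.mem_Icc.mp hp).2)⟩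
  · rintro ⟨a, b, hT, hac, hcb⟩ h
    have hab : a ≤ b := Fin.le_def.mpr (hac.le.trans hcb)
    rcases h _ hT with h | h
    · exact (h b (Finset.right_mem_Icc.mpr hab)).not_ge hcb
    · exact (h a (Finset.left_mem_Icc.mpr hab)).not_gt hac

lemma isCut_left {a b : Fin N} (hab : a ≤ b) (hM : Finset.Icc a b ∈ M.gates) : M.IsCut a := by
  by_contra h
  obtain ⟨a', b', hM', ha, hb⟩ := not_isCut_iff.mp h
  have heq := M.eq_of_mem_of_mem hM hM' (Finset.left_mem_Icc.mpr hab)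
    (Finset.mem_Icc.mpr ⟨ha.le, hb⟩)
  have ha' : a' ∈ Finset.Icc a b := heq ▸ Finset.left_mem_Icc.mpr (ha.le.trans hb)
  exact (Finset.mem_Icc.mp ha').1.not_gt ha

lemma isCut_right {a b : Fin N} (hab : a ≤ b) (hM : Finset.Icc a b ∈ M.gates) :
    M.IsCut (b + 1) := by
  by_contra h
  obtain ⟨a', b', hM', ha, hb⟩ := not_isCut_iff.mp h
  have hab' : a' ≤ b ∧ b < b' := ⟨Nat.lt_add_one_iff.mp ha, hb⟩
  have heq := M.eq_of_mem_of_mem hM hM' (Finset.right_mem_Icc.mpr hab)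
    (Finset.mem_Icc.mpr ⟨hab'.1, hab'.2.le⟩)
  have hb' : b' ∈ Finset.Icc a b := heq ▸ Finset.right_mem_Icc.mpr (hab'.1.trans hab'.2.le)
  exact (Finset.mem_Icc.mp hb').2.not_gt hab'.2

lemma exists_isCut_le_isCut {pos : Fin n ↪ Fin N} {κ : ℕ}
    (hM : ∀ T ∈ M.gates, inputCount pos T ≤ κ) (c : ℕ) :
    ∃ l r, l ≤ c ∧ c ≤ r ∧ M.IsCut l ∧ M.IsCut r ∧ inputCount pos (seg l r) ≤ κ := by
  by_cases hc : M.IsCut c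
  · exact ⟨c, c, le_rfl, le_rfl, hc, hc, by simp [seg_self, inputCount_empty]⟩
  · obtain ⟨a, b, hT, hac, hcb⟩ := not_isCut_iff.mp hc
    have hab : a ≤ b := Fin.le_def.mpr (hac.le.trans hcb)
    refine ⟨a, b + 1, hac.le, hcb.trans b.val.le_succ, isCut_left hab hT, isCut_right hab hT, ?_⟩
    rw [seg_val_val_add_one, ← Finset.coe_Icc]
    exact hM _ hT

lemma IsCut.hasLightCone {l r : ℕ} (hl : M.IsCut l) (hr : M.IsCut r) :
    HasLightCone M.toMatrix (seg l r) (seg l r) := by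
  refine CZLayer.hasLightCone fun T hT => ?_
  rcases hl T hT with hTl | hTl
  · exact .inr fun q hq hq' => (hTl q hq).not_ge hq'.1
  rcases hr T hT with hTr | hTr
  · exact .inl fun q hq => ⟨hTl q hq, hTr q hq⟩
  · exact .inr fun q hq hq' => (hTr q hq).not_gt hq'.2

/-- The layer that keeps only the gates acting on at most `κ` input qubits. -/
noncomputable def lightGates (M : CZLayer N) (pos : Fin n ↪ Fin N) (κ : ℕ) : CZLayer N :=
  M.filter fun T => inputCount pos T ≤ κ

/-- The layer that keeps only the gates acting on more than `κ` input qubits. -/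
noncomputable def heavyGates (M : CZLayer N) (pos : Fin n ↪ Fin N) (κ : ℕ) : CZLayer N :=
  M.filter fun T => ¬ inputCount pos T ≤ κ

lemma toMatrix_lightGates_mul_toMatrix_heavyGates (M : CZLayer N) (κ : ℕ) :
    (M.lightGates pos κ).toMatrix * (M.heavyGates pos κ).toMatrix = M.toMatrix :=
  M.toMatrix_filter_mul_toMatrix_filter_not _

end CZLayer

/-- The circuit obtained by deleting, from the `j`-th layer of controlled-Z gates, all gates that
act on more than `k * 3 ^ (j - 1)` input qubits. In the remaining circuit the light cones grow by
at most two gates per layer, and the thresholds are geometric so that a deleted gate of layer `j`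
still covers the light cone of `k` inputs through the first `j - 1` layers. -/
noncomputable def Circuit.prune (pos : Fin n ↪ Fin N) (k : ℕ) :
    {d : ℕ} → Circuit N d → Circuit N d
  | _, .base L => .base L
  | _, .step (d := d) C M L =>
    .step (C.prune pos k) (M.lightGates pos (k * 3 ^ d)) L

lemma Circuit.exists_hasLightCone_prune (k : ℕ) {d : ℕ} (C : Circuit N d) (l r : ℕ) :
    ∃ l' r', inputCount pos (seg l r) + k ≤ inputCount pos (seg l' r') + k * 3 ^ d ∧
      HasLightCone (C.prune pos k).toMatrix (seg l' r') (seg l r) := by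
  induction C generalizing l r with
  | base L => exact ⟨l, r, by simp, L.hasLightCone _⟩
  | @step d C M L ih =>
    set M' := M.lightGates pos (k * 3 ^ d)
    have hlight : ∀ T ∈ M'.gates, inputCount pos T ≤ k * 3 ^ d :=
      fun T hT => (Finset.mem_filter.mp hT).2
    obtain ⟨l₀, l₁, hl₀, hl₁, -, hcut_l, hcount_l⟩ := M'.exists_isCut_le_isCut hlight l
    obtain ⟨r₁, r₂, hr₁, hr₂, hcut_r, -, hcount_r⟩ := M'.exists_isCut_le_isCut hlight r
    obtain ⟨l', r', hcount, hcone⟩ := ih l₁ r₁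
    refine ⟨l', r', ?_, ?_⟩
    · have hsplit := inputCount_seg_le pos l l₁ r₁ r
      have hleft := (inputCount_mono pos (seg_subset_seg hl₀ le_rfl)).trans hcount_l
      have hright := (inputCount_mono pos (seg_subset_seg le_rfl hr₂)).trans hcount_r
      rw [pow_succ, ← mul_assoc]
      omega
    · exact (((L.hasLightCone _).mul (hcut_l.hasLightCone hcut_r)).mul hcone).mono_right
        (seg_subset_seg hl₁ hr₁)

end Segments

section States

variable {n N : ℕ} {pos : Fin n ↪ Fin N} (a : EuclideanSpace ℂ (Bits (Ancilla pos)))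
  (x : Bits (Fin n))

lemma norm_initialState : ‖toLp 2 (initialState pos a x)‖ = ‖a‖ := by
  refine (sq_eq_sq₀ (norm_nonneg _) (norm_nonneg _)).mp ?_
  simp only [EuclideanSpace.norm_sq_eq, initialState, apply_ite norm, ite_pow, norm_zero,
    zero_pow two_ne_zero, ← Finset.sum_filter]
  have hanc (q : Ancilla pos) : ¬ ∃ i, pos i = q := fun ⟨i, hi⟩ => q.2 i hi
  refine Finset.sum_nbij' (fun y q => y q)
    (fun z => Function.extend pos x (Function.extend Subtype.val z 0))
    (fun _ _ => Finset.mem_univ _) (fun z _ => ?_) (fun y hy => funext fun q => ?_)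
    (fun z _ => funext fun q => ?_) (fun _ _ => rfl)
  · exact Finset.mem_filter.mpr ⟨Finset.mem_univ _, pos.injective.extend_apply x _⟩
  · by_cases hq : ∃ i, pos i = q
    · obtain ⟨i, rfl⟩ := hq
      rw [pos.injective.extend_apply, (Finset.mem_filter.mp hy).2 i]
    · rw [Function.extend_apply' _ _ _ hq]
      exact Subtype.val_injective.extend_apply _ _ ⟨q, not_exists.mp hq⟩
  · rw [Function.extend_apply' _ _ _ (hanc q), Subtype.val_injective.extend_apply]

variable {a x}

lemma IsLocal.eqOn_of_mulVec_initialState_ne_zero {B : Matrix (Bits (Fin N)) (Bits (Fin N)) ℂ}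
    {K : Set (Fin N)} (hB : IsLocal Kᶜ B) {y : Bits (Fin N)}
    (hy : (B *ᵥ initialState pos a x) y ≠ 0) : EqOn (y ∘ pos) x (pos ⁻¹' K) := by
  obtain ⟨u, -, hu⟩ := Finset.exists_ne_zero_of_sum_ne_zero hy
  intro i hi
  have hyu : y (pos i) = u (pos i) :=
    hB.eqOn_compl (left_ne_zero_of_mul hu) (not_notMem.mpr hi)
  have hux : ∀ j, u (pos j) = x j := by
    by_contra h
    exact right_ne_zero_of_mul hu (if_neg h)
  exact hyu.trans (hux i)

variable (a x)

/-- The state `C (|x⟩ ⊗ |a⟩)` just before the measurement. -/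
noncomputable def Circuit.finalState {d : ℕ} (C : Circuit N d) : Bits (Fin N) → ℂ :=
  C.toMatrix *ᵥ initialState pos a x

lemma Circuit.norm_finalState {d : ℕ} (C : Circuit N d) : ‖toLp 2 (C.finalState a x)‖ = ‖a‖ := by
  rw [finalState, norm_mulVec_of_mem_unitaryGroup C.toMatrix_mem_unitaryGroup, norm_initialState]

end States

section AllOnes

lemma IsLocal.sum_norm_sq_mulVec_le {ι : Type} [Fintype ι] {𝕜 : Type*} [RCLike 𝕜] [DecidableEq ι]
    {S : Set ι} {A : Matrix (Bits ι) (Bits ι) 𝕜} (hA : IsLocal S A) {z : Bits ι}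
    {E P : Finset (Bits ι)} (hE : ∀ y ∈ E, EqOn y z S)
    (hP : ∀ ⦃m : Bits ι⦄, EqOn m 0 S → ∀ u ∈ P, u + m ∈ P) {v : Bits ι → 𝕜}
    (hv : ∀ u, v u ≠ 0 → u ∈ P) :
    ∑ y ∈ E, ‖(A *ᵥ v) y‖ ^ 2 ≤ (∑ u ∈ P, ‖A z u‖ ^ 2) * ‖toLp 2 v‖ ^ 2 := by
  classical
  have hrow : ∀ y ∈ E, ∑ u ∈ P, ‖A y u‖ ^ 2 = ∑ u ∈ P, ‖A z u‖ ^ 2 := by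
    intro y hy
    have hm : EqOn (z - y) 0 S := fun q hq => by simp [hE y hy hq]
    have hm' : EqOn (y - z) 0 S := fun q hq => by simp [hE y hy hq]
    refine Finset.sum_nbij' (· + (z - y)) (· + (y - z)) (hP hm) (hP hm')
      (fun u _ => ?_) (fun u _ => ?_) fun u _ => ?_
    · rw [add_assoc, sub_add_sub_cancel, sub_self, add_zero]
    · rw [add_assoc, sub_add_sub_cancel, sub_self, add_zero]
    · rw [← hA.apply_add_add hm y u, add_sub_cancel]
  have hfiber : ∀ y ∈ E, ∀ u, A y u ≠ 0 → u ∈ Finset.univ.filter (S.piecewise z · = y) := by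
    refine fun y hy u hu => Finset.mem_filter.mpr ⟨Finset.mem_univ _, funext fun q => ?_⟩
    by_cases hq : q ∈ S
    · rw [piecewise_eq_of_mem _ _ _ hq, hE y hy hq]
    · rw [piecewise_eq_of_notMem _ _ _ hq, hA.eqOn_compl hu hq]
  calc ∑ y ∈ E, ‖(A *ᵥ v) y‖ ^ 2
      ≤ ∑ y ∈ E, (∑ u ∈ P, ‖A z u‖ ^ 2) * ∑ u with S.piecewise z u = y, ‖v u‖ ^ 2 := by
        gcongr with y hy
        rw [← hrow y hy]
        exact norm_mulVec_apply_sq_le A hv (hfiber y hy)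
    _ ≤ (∑ u ∈ P, ‖A z u‖ ^ 2) * ‖toLp 2 v‖ ^ 2 := by
        rw [← Finset.mul_sum, EuclideanSpace.norm_sq_eq]
        gcongr
        exact Finset.sum_fiberwise_le_sum_of_sum_fiber_nonneg fun y _ => by positivity

open scoped Classical in
lemma card_filter_eqOn_mul_two_pow {α : Type} [Fintype α] [DecidableEq α] (J : Set α) (v : Bits α) :
    (Finset.univ.filter fun x : Bits α => EqOn v x J).card * 2 ^ J.ncard =
      2 ^ Fintype.card α := by
  have hpi : (Finset.univ.filter fun x : Bits α => EqOn v x J) =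
      Fintype.piFinset fun i => if i ∈ J then {v i} else Finset.univ := by
    ext x
    simp only [Finset.mem_filter, Finset.mem_univ, true_and, Fintype.mem_piFinset]
    refine forall_congr' fun i => ?_
    by_cases hi : i ∈ J <;> simp [hi, eq_comm]
  have hpow : 2 ^ J.ncard = ∏ i : α, if i ∈ J then 2 else 1 := by
    rw [Finset.prod_ite, Finset.prod_const, Finset.prod_const_one, mul_one,
      ncard_eq_toFinset_card', filter_mem_univ_eq_toFinset]
  rw [hpi, Fintype.card_piFinset, hpow, ← Finset.prod_mul_distrib]
  refine (Finset.prod_congr rfl fun i _ => ?_).trans (Finset.prod_const 2)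
  by_cases hi : i ∈ J <;> simp [hi]

open scoped Classical in
lemma sum_sum_filter_eqOn_mul_two_pow {α β : Type} [Fintype α] [DecidableEq α] [Fintype β]
    (J : Set α) (g : β → Bits α) (f : β → ℝ) :
    (∑ x : Bits α, ∑ u with EqOn (g u) x J, f u) * 2 ^ J.ncard =
      2 ^ Fintype.card α * ∑ u, f u := by
  simp only [Finset.sum_filter]
  rw [Finset.sum_comm, Finset.sum_mul, Finset.mul_sum]
  refine Finset.sum_congr rfl fun u _ => ?_
  rw [← Finset.sum_filter, Finset.sum_const, nsmul_eq_mul, mul_right_comm]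
  exact_mod_cast congrArg (· * f u) (congrArg (Nat.cast (R := ℝ))
    (card_filter_eqOn_mul_two_pow J (g u)))

/-- The basis states that are `1` on all of `T`; a controlled-Z gate on `T` negates exactly
these. -/
def allOnes {ι : Type} [Fintype ι] [DecidableEq ι] (T : Finset ι) : Finset (Bits ι) :=
  {y | ∀ q ∈ T, y q = 1}

lemma mem_allOnes {ι : Type} [Fintype ι] [DecidableEq ι] {T : Finset ι} {y : Bits ι} :
    y ∈ allOnes T ↔ ∀ q ∈ T, y q = 1 := by
  simp [allOnes]

variable {n N : ℕ} {pos : Fin n ↪ Fin N}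

/-- The amplitude of an all-ones state is bounded by the norm of a row of the factor of `U` acting
on `T`, restricted to the columns that carry the input `x` on `K`; averaging over `x` distributes
the whole row, whose norm is `1`, evenly over the values of `x` on `K`. -/
lemma HasLightCone.sum_allOnes_mul_two_pow_le {U : Matrix (Bits (Fin N)) (Bits (Fin N)) ℂ}
    {K : Set (Fin N)} {T : Finset (Fin N)} (hU : HasLightCone U K T)
    (a : EuclideanSpace ℂ (Bits (Ancilla pos))) :
    (∑ x, ∑ y ∈ allOnes T, ‖(U *ᵥ initialState pos a x) y‖ ^ 2) * 2 ^ inputCount pos K ≤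
      2 ^ n * ‖a‖ ^ 2 := by
  classical
  obtain ⟨hKT, A, hA, B, hB, hAT, hBK, rfl⟩ := hU
  have hweight (x : Bits (Fin n)) :
      ∑ y ∈ allOnes T, ‖((A * B) *ᵥ initialState pos a x) y‖ ^ 2 ≤
        (∑ u with EqOn (u ∘ pos) x (pos ⁻¹' K), ‖A 1 u‖ ^ 2) * ‖a‖ ^ 2 := by
    rw [← mulVec_mulVec, ← norm_initialState a x, ← norm_mulVec_of_mem_unitaryGroup hB]
    refine hAT.sum_norm_sq_mulVec_le (fun y hy => mem_allOnes.mp hy) (fun m hm u hu => ?_)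
      fun u hu => Finset.mem_filter.mpr
        ⟨Finset.mem_univ _, hBK.eqOn_of_mulVec_initialState_ne_zero hu⟩
    refine Finset.mem_filter.mpr ⟨Finset.mem_univ _, fun i hi => ?_⟩
    simpa [hm (hKT hi)] using (Finset.mem_filter.mp hu).2 hi
  calc (∑ x, ∑ y ∈ allOnes T, ‖((A * B) *ᵥ initialState pos a x) y‖ ^ 2) * 2 ^ inputCount pos K
      ≤ (∑ x, (∑ u with EqOn (u ∘ pos) x (pos ⁻¹' K), ‖A 1 u‖ ^ 2) * ‖a‖ ^ 2) *
          2 ^ inputCount pos K := by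
        gcongr with x
        exact hweight x
    _ = (∑ x, ∑ u with EqOn (u ∘ pos) x (pos ⁻¹' K), ‖A 1 u‖ ^ 2) * 2 ^ (pos ⁻¹' K).ncard *
          ‖a‖ ^ 2 := by
        rw [← Finset.sum_mul, mul_right_comm, inputCount]
    _ = 2 ^ n * ‖a‖ ^ 2 := by
        rw [sum_sum_filter_eqOn_mul_two_pow, sum_norm_sq_row_of_mem_unitaryGroup hA,
          Fintype.card_fin, mul_one]

end AllOnes

section Pruning

variable {n N d : ℕ} {pos : Fin n ↪ Fin N}

namespace CZLayer

lemma norm_phase_sub_one_sq_le (M : CZLayer N) (y : Bits (Fin N)) :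
    ‖M.phase y - 1‖ ^ 2 ≤ 4 * (M.gates.filter (y ∈ allOnes ·)).card := by
  by_cases h : ∃ T ∈ M.gates, y ∈ allOnes T
  · have hcard : (1 : ℝ) ≤ (M.gates.filter (y ∈ allOnes ·)).card := by
      exact_mod_cast Finset.card_pos.mpr (Finset.filter_nonempty_iff.mpr h)
    have hphase : ‖M.phase y - 1‖ ^ 2 ≤ 4 := by
      rcases M.phase_eq_one_or_neg_one y with h | h <;> norm_num [h]
    linarith
  · have hphase : M.phase y = 1 := by
      refine Finset.prod_eq_one fun T hT => ?_
      rw [czGate, diagonal_apply_eq, if_neg fun hy => h ⟨T, hT, mem_allOnes.mpr hy⟩]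
    simp [hphase]

lemma norm_toMatrix_mulVec_sub_sq_le (M : CZLayer N) (v : Bits (Fin N) → ℂ) :
    ‖toLp 2 (M.toMatrix *ᵥ v - v)‖ ^ 2 ≤ 4 * ∑ T ∈ M.gates, ∑ y ∈ allOnes T, ‖v y‖ ^ 2 := by
  have hcount : ∑ T ∈ M.gates, ∑ y ∈ allOnes T, ‖v y‖ ^ 2 =
      ∑ y, (M.gates.filter (y ∈ allOnes ·)).card * ‖v y‖ ^ 2 := by
    rw [Finset.sum_comm' (t' := Finset.univ) (s' := fun y => M.gates.filter (y ∈ allOnes ·))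
      (by simp)]
    simp
  rw [EuclideanSpace.norm_sq_eq, hcount, Finset.mul_sum]
  refine Finset.sum_le_sum fun y _ => ?_
  have hy : (M.toMatrix *ᵥ v - v) y = (M.phase y - 1) * v y := by
    rw [Pi.sub_apply, toMatrix_eq_diagonal_phase, mulVec_diagonal, sub_mul, one_mul]
  rw [PiLp.toLp_apply, hy, norm_mul, mul_pow, ← mul_assoc]
  gcongr
  exact M.norm_phase_sub_one_sq_le y

lemma card_gates_le (M : CZLayer N) (hM : ∀ T ∈ M.gates, 0 < inputCount pos T) :
    M.gates.card ≤ n := by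
  have hinput : ∀ T ∈ M.gates, ∃ i ∈ Finset.univ, pos i ∈ T := fun T hT =>
    (nonempty_of_ncard_ne_zero (hM T hT).ne').imp fun i hi => ⟨Finset.mem_univ i, hi⟩
  simpa using Finset.card_le_card_of_forall_subsingleton (fun T i => pos i ∈ T) hinput
    fun i _ T hT T' hT' => M.eq_of_mem_of_mem hT.1 hT'.1 hT.2 hT'.2

end CZLayer

namespace Circuit

variable {a : EuclideanSpace ℂ (Bits (Ancilla pos))}

lemma sum_allOnes_finalState_prune_le (C : Circuit N d) (k : ℕ) (ha : ‖a‖ = 1) {u v : Fin N}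
    (huv : k * 3 ^ d < inputCount pos (Finset.Icc u v : Finset (Fin N))) :
    ∑ x, ∑ y ∈ allOnes (Finset.Icc u v), ‖(C.prune pos k).finalState a x y‖ ^ 2 ≤
      2 ^ n / 2 ^ k := by
  obtain ⟨l, r, hcount, hcone⟩ := C.exists_hasLightCone_prune pos k u (v + 1)
  rw [seg_val_val_add_one, ← Finset.coe_Icc] at hcount hcone
  rw [le_div_iff₀ (by positivity)]
  calc _ ≤ (∑ x, ∑ y ∈ allOnes (Finset.Icc u v), ‖(C.prune pos k).finalState a x y‖ ^ 2) *
        2 ^ inputCount pos (seg l r) := by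
        gcongr
        · norm_num
        · omega
    _ ≤ 2 ^ n := by simpa [ha, finalState] using hcone.sum_allOnes_mul_two_pow_le a

lemma sum_norm_sq_heavyGates_sub_le (C : Circuit N d) (M : CZLayer N) (k : ℕ) (ha : ‖a‖ = 1) :
    ∑ x, ‖toLp 2 ((M.heavyGates pos (k * 3 ^ d)).toMatrix *ᵥ (C.prune pos k).finalState a x -
      (C.prune pos k).finalState a x)‖ ^ 2 ≤ 4 * (n * (2 ^ n / 2 ^ k)) := by
  set φ := (C.prune pos k).finalState a
  set M' := M.heavyGates pos (k * 3 ^ d)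
  have hheavy : ∀ T ∈ M'.gates, k * 3 ^ d < inputCount pos T := fun T hT =>
    not_le.mp (Finset.mem_filter.mp hT).2
  calc ∑ x, ‖toLp 2 (M'.toMatrix *ᵥ φ x - φ x)‖ ^ 2
      ≤ ∑ x, 4 * ∑ T ∈ M'.gates, ∑ y ∈ allOnes T, ‖φ x y‖ ^ 2 := by
        gcongr with x
        exact M'.norm_toMatrix_mulVec_sub_sq_le _
    _ = 4 * ∑ T ∈ M'.gates, ∑ x, ∑ y ∈ allOnes T, ‖φ x y‖ ^ 2 := by
        rw [← Finset.mul_sum, Finset.sum_comm]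
    _ ≤ 4 * ∑ T ∈ M'.gates, (2 ^ n / 2 ^ k : ℝ) := by
        gcongr with T hT
        obtain ⟨u, v, -, rfl⟩ := M'.interval T hT
        exact C.sum_allOnes_finalState_prune_le k ha (hheavy _ hT)
    _ ≤ 4 * (n * (2 ^ n / 2 ^ k)) := by
        rw [Finset.sum_const, nsmul_eq_mul]
        gcongr
        exact M'.card_gates_le fun T hT => (Nat.zero_le _).trans_lt (hheavy T hT)

lemma sum_norm_heavyGates_sub_le (C : Circuit N d) (M : CZLayer N) (k : ℕ) (ha : ‖a‖ = 1) :
    ∑ x, ‖toLp 2 ((M.heavyGates pos (k * 3 ^ d)).toMatrix *ᵥ (C.prune pos k).finalState a x -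
      (C.prune pos k).finalState a x)‖ ≤ 2 ^ n * (2 * √(n / 2 ^ k)) := by
  have hcard : (Fintype.card (Bits (Fin n)) : ℝ) = 2 ^ n := by simp
  refine le_of_sq_le_sq (sq_sum_le_card_mul_sum_sq.trans ?_) (by positivity)
  rw [Finset.card_univ, hcard, mul_pow, mul_pow, Real.sq_sqrt (by positivity), sq (2 ^ n : ℝ),
    mul_assoc]
  gcongr
  exact (C.sum_norm_sq_heavyGates_sub_le M k ha).trans_eq (by ring)

lemma norm_finalState_step_sub_prune_le (C : Circuit N d) (M : CZLayer N) (L : SingleLayer N)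
    (k : ℕ) (a : EuclideanSpace ℂ (Bits (Ancilla pos))) (x : Bits (Fin n)) :
    ‖toLp 2 ((Circuit.step C M L).finalState a x -
        ((Circuit.step C M L).prune pos k).finalState a x)‖ ≤
      ‖toLp 2 (C.finalState a x - (C.prune pos k).finalState a x)‖ +
        ‖toLp 2 ((M.heavyGates pos (k * 3 ^ d)).toMatrix *ᵥ (C.prune pos k).finalState a x -
          (C.prune pos k).finalState a x)‖ := by
  set light := M.lightGates pos (k * 3 ^ d)
  set heavy := M.heavyGates pos (k * 3 ^ d)
  have hM : M.toMatrix = light.toMatrix * heavy.toMatrix :=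
    (M.toMatrix_lightGates_mul_toMatrix_heavyGates pos _).symm
  have hdecomp : (Circuit.step C M L).finalState a x -
      ((Circuit.step C M L).prune pos k).finalState a x =
      (L.toMatrix * M.toMatrix) *ᵥ (C.finalState a x - (C.prune pos k).finalState a x) +
      (L.toMatrix * light.toMatrix) *ᵥ
        (heavy.toMatrix *ᵥ (C.prune pos k).finalState a x - (C.prune pos k).finalState a x) := by
    have hC : (Circuit.step C M L).toMatrix = L.toMatrix * M.toMatrix * C.toMatrix := rfl
    have hprune : ((Circuit.step C M L).prune pos k).toMatrix =
      L.toMatrix * light.toMatrix * (C.prune pos k).toMatrix := rfl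
    simp only [finalState, hC, hprune, hM, mulVec_sub, mulVec_mulVec, mul_assoc]
    abel
  rw [hdecomp, toLp_add]
  refine (norm_add_le _ _).trans_eq ?_
  rw [norm_mulVec_of_mem_unitaryGroup (mul_mem L.toMatrix_mem_unitaryGroup
      M.toMatrix_mem_unitaryGroup), norm_mulVec_of_mem_unitaryGroup
    (mul_mem L.toMatrix_mem_unitaryGroup light.toMatrix_mem_unitaryGroup)]

lemma sum_norm_finalState_sub_prune_le (C : Circuit N d) (k : ℕ) (ha : ‖a‖ = 1) :
    ∑ x, ‖toLp 2 (C.finalState a x - (C.prune pos k).finalState a x)‖ ≤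
      d * (2 ^ n * (2 * √(n / 2 ^ k))) := by
  induction C with
  | base L => simp [Circuit.prune]
  | step C M L ih =>
    refine (Finset.sum_le_sum fun x _ =>
      norm_finalState_step_sub_prune_le C M L k a x).trans ?_
    rw [Finset.sum_add_distrib]
    push_cast
    linarith [C.sum_norm_heavyGates_sub_le M k ha]

end Circuit

end Pruning

section Output

variable {n N d : ℕ} {pos : Fin n ↪ Fin N} {a : EuclideanSpace ℂ (Bits (Ancilla pos))}

lemma outputProb_eq_sum_finalState (C : Circuit N d) (out : Fin N) (x : Bits (Fin n))
    (b : Fin 2) : outputProb C pos a out x b =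
      ∑ y : Bits (Fin N) with y out = b, ‖C.finalState a x y‖ ^ 2 := rfl

lemma outputProb_nonneg (C : Circuit N d) (out : Fin N) (x : Bits (Fin n)) (b : Fin 2) :
    0 ≤ outputProb C pos a out x b :=
  Finset.sum_nonneg fun _ _ => by positivity

lemma sum_outputProb (C : Circuit N d) (ha : ‖a‖ = 1) (out : Fin N) (x : Bits (Fin n)) :
    ∑ b, outputProb C pos a out x b = 1 := by
  simp only [outputProb_eq_sum_finalState]
  rw [Finset.sum_fiberwise, ← EuclideanSpace.norm_sq_eq (toLp 2 (C.finalState a x)),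
    C.norm_finalState, ha, one_pow]

lemma outputProb_le_one (C : Circuit N d) (ha : ‖a‖ = 1) (out : Fin N) (x : Bits (Fin n))
    (b : Fin 2) : outputProb C pos a out x b ≤ 1 :=
  sum_outputProb C ha out x ▸
    Finset.single_le_sum (fun b _ => outputProb_nonneg C out x b) (Finset.mem_univ b)

lemma successProb_le_one (C : Circuit N d) (ha : ‖a‖ = 1) (out : Fin N)
    (h : Bits (Fin n) → Fin 2) : successProb C pos a out h ≤ 1 := by
  rw [successProb, div_le_one (by positivity)]
  refine (Finset.sum_le_sum fun x _ => outputProb_le_one C ha out x (h x)).trans_eq ?_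
  simp

lemma successProb_le_prune (C : Circuit N d) (ha : ‖a‖ = 1) (out : Fin N) (k : ℕ)
    (h : Bits (Fin n) → Fin 2) :
    successProb C pos a out h ≤
      successProb (C.prune pos k) pos a out h + 4 * d * √(n / 2 ^ k) := by
  have hx (x : Bits (Fin n)) : outputProb C pos a out x (h x) ≤
      outputProb (C.prune pos k) pos a out x (h x) +
        2 * ‖toLp 2 (C.finalState a x - (C.prune pos k).finalState a x)‖ :=
    sum_norm_sq_le_add_two_mul_norm_sub _ ((C.norm_finalState a x).trans ha).le
      (((C.prune pos k).norm_finalState a x).trans ha).le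
  have hsum := Finset.sum_le_sum fun x (_ : x ∈ Finset.univ) => hx x
  rw [Finset.sum_add_distrib, ← Finset.mul_sum] at hsum
  rw [successProb, successProb, div_add' _ _ _ (by positivity)]
  gcongr
  linarith [C.sum_norm_finalState_sub_prune_le k ha]

end Output

section IgnoredInput

/-- Flips the bit at `i`. Since `Fin 2` is a group, this is a translation. -/
def flipBit {ι : Type} [DecidableEq ι] (i : ι) : Equiv.Perm (Bits ι) :=
  Equiv.addRight (Pi.single i 1)

section FlipBit

variable {ι : Type} [DecidableEq ι] {i j : ι}

lemma flipBit_apply (x : Bits ι) : flipBit i x = x + Pi.single i 1 := rfl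

lemma flipBit_apply_of_ne (h : j ≠ i) (x : Bits ι) : flipBit i x j = x j := by
  simp [flipBit_apply, h]

lemma flipBit_flipBit (x : Bits ι) : flipBit i (flipBit i x) = x := by
  rw [flipBit_apply, flipBit_apply, add_assoc, ← Pi.single_add]
  simp

end FlipBit

lemma IsLocal.sum_norm_sq_mulVec_eq {ι : Type} [Fintype ι] [DecidableEq ι] {𝕜 : Type*} [RCLike 𝕜]
    {S : Set ι} {A : Matrix (Bits ι) (Bits ι) 𝕜} (hAS : IsLocal S A)
    (hA : A ∈ unitaryGroup (Bits ι) 𝕜) {q : ι} (hq : q ∉ S) (b : Fin 2) (v : Bits ι → 𝕜) :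
    ∑ y : Bits ι with y q = b, ‖(A *ᵥ v) y‖ ^ 2 = ∑ y : Bits ι with y q = b, ‖v y‖ ^ 2 := by
  set P : Matrix (Bits ι) (Bits ι) 𝕜 := Matrix.diagonal fun y => if y q = b then 1 else 0
  have hP (w : Bits ι → 𝕜) :
      indicator (Finset.univ.filter fun y : Bits ι => y q = b : Finset (Bits ι)) w = P *ᵥ w := by
    funext y
    simp [P, mulVec_diagonal, indicator_apply]
  have hPlocal : IsLocal {q} P := IsLocal.diagonal fun y x hyx => by simp only [hyx rfl]
  have hcomm : P * A = A * P :=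
    (hAS.commute_of_disjoint hPlocal (disjoint_singleton_right.mpr hq)).symm
  rw [sum_norm_sq_eq_norm_indicator_sq, sum_norm_sq_eq_norm_indicator_sq, hP, hP, mulVec_mulVec,
    hcomm, ← mulVec_mulVec, norm_mulVec_of_mem_unitaryGroup hA]

variable {n N : ℕ} {pos : Fin n ↪ Fin N} (a : EuclideanSpace ℂ (Bits (Ancilla pos)))

lemma initialState_flipBit (x : Bits (Fin n)) (i : Fin n) (y : Bits (Fin N)) :
    initialState pos a (flipBit i x) (flipBit (pos i) y) = initialState pos a x y := by
  have hinput (j : Fin n) : flipBit (pos i) y (pos j) = flipBit i x j ↔ y (pos j) = x j := by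
    have hsingle : (Pi.single (pos i) 1 : Bits (Fin N)) (pos j) =
        (Pi.single i 1 : Bits (Fin n)) j := by
      simp [Pi.single_apply]
    rw [flipBit_apply, flipBit_apply, Pi.add_apply, Pi.add_apply, hsingle, add_left_inj]
  have hancilla : (fun q : Ancilla pos => flipBit (pos i) y q) = fun q : Ancilla pos => y q :=
    funext fun q => flipBit_apply_of_ne (q.2 i).symm y
  simp only [initialState, hinput, hancilla]

variable {a}

lemma IsLocal.mulVec_initialState_flipBit {B : Matrix (Bits (Fin N)) (Bits (Fin N)) ℂ}
    {K : Set (Fin N)} (hB : IsLocal Kᶜ B) {i : Fin n} (hi : pos i ∈ K) (x : Bits (Fin n))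
    (y : Bits (Fin N)) :
    (B *ᵥ initialState pos a (flipBit i x)) (flipBit (pos i) y) =
      (B *ᵥ initialState pos a x) y := by
  have hsingle : EqOn (Pi.single (pos i) 1 : Bits (Fin N)) 0 Kᶜ := fun q hq =>
    Pi.single_eq_of_ne (fun h : q = pos i => hq (h ▸ hi)) _
  simp only [mulVec, dotProduct]
  rw [← Equiv.sum_comp (flipBit (pos i))]
  refine Finset.sum_congr rfl fun u _ => ?_
  rw [initialState_flipBit, flipBit_apply, flipBit_apply, hB.apply_add_add hsingle]

namespace Circuit

variable {d : ℕ}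

lemma outputProb_flipBit (C : Circuit N d) {K S : Set (Fin N)} (hC : HasLightCone C.toMatrix K S)
    {i : Fin n} (hi : pos i ∈ K) {out : Fin N} (hout : out ∉ S) (x : Bits (Fin n)) (b : Fin 2) :
    outputProb C pos a out (flipBit i x) b = outputProb C pos a out x b := by
  obtain ⟨hKS, A, hA, B, -, hAS, hBK, hAB⟩ := hC
  have hne : out ≠ pos i := fun h => hout (h ▸ hKS hi)
  simp only [outputProb, hAB, ← mulVec_mulVec, hAS.sum_norm_sq_mulVec_eq hA hout]
  refine (Finset.sum_equiv (flipBit (pos i)) (fun y => ?_) fun y _ => ?_).symm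
  · simp only [Finset.mem_filter, Finset.mem_univ, true_and, flipBit_apply_of_ne hne]
  · rw [hBK.mulVec_initialState_flipBit hi]

/-- One of the two sides of the output qubit carries at least `k * 3 ^ d` inputs, and the light
cones of at least `k` of them stay on that side. -/
lemma exists_forall_outputProb_prune_flipBit (C : Circuit N d) (out : Fin N) {k : ℕ} (hk : 0 < k)
    (hn : 2 * (k * 3 ^ d) + 1 ≤ n) :
    ∃ i, ∀ x b, outputProb (C.prune pos k) pos a out (flipBit i x) b =
      outputProb (C.prune pos k) pos a out x b := by
  obtain ⟨l, r, hout, hlr⟩ : ∃ l r : ℕ, out ∉ (seg l r : Set (Fin N)) ∧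
      k * 3 ^ d ≤ inputCount pos (seg l r) := by
    have hsplit := inputCount_seg_le pos 0 out (out + 1) N
    have huniv : inputCount pos (seg 0 N) = n := by
      simp [inputCount, seg, preimage, ncard_eq_toFinset_card']
    have hone : inputCount pos (seg out (out + 1)) ≤ 1 := by
      rw [seg_val_val_add_one, Icc_self]
      exact (ncard_le_one_iff (toFinite _)).mpr fun hi hj =>
        pos.injective ((mem_singleton_iff.mp hi).trans (mem_singleton_iff.mp hj).symm)
    rcases le_or_gt (k * 3 ^ d) (inputCount pos (seg 0 (out : ℕ))) with h | h
    · exact ⟨0, out, by simp, h⟩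
    · exact ⟨out + 1, N, by simp, by omega⟩
  obtain ⟨l', r', hcount, hcone⟩ := C.exists_hasLightCone_prune pos k l r
  have hpos : inputCount pos (seg l' r') ≠ 0 := by omega
  obtain ⟨i, hi⟩ := nonempty_of_ncard_ne_zero hpos
  exact ⟨i, outputProb_flipBit _ hcone hi hout⟩

end Circuit

end IgnoredInput

section Influence

/-- The influence of bit `i` on the Boolean function `h`: the probability that flipping bit `i` of
a uniformly random string changes the value of `h`. -/
noncomputable def influence {ι : Type} [Fintype ι] [DecidableEq ι] (h : Bits ι → Fin 2)
    (i : ι) : ℝ :=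
  (Finset.univ.filter fun x => h x ≠ h (flipBit i x)).card / 2 ^ Fintype.card ι

lemma two_mul_card_pivotal_of_eq_zero {ι : Type} [Fintype ι] [DecidableEq ι]
    (h : Bits ι → Fin 2) (i : ι) :
    2 * (Finset.univ.filter fun x => h x ≠ h (flipBit i x) ∧ x i = 0).card =
      (Finset.univ.filter fun x => h x ≠ h (flipBit i x)).card := by
  have hflip : (Finset.univ.filter fun x => h x ≠ h (flipBit i x) ∧ ¬ x i = 0).card =
      (Finset.univ.filter fun x => h x ≠ h (flipBit i x) ∧ x i = 0).card := by
    refine Finset.card_equiv (flipBit i) fun x => ?_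
    have hi : ¬ x i = 0 ↔ flipBit i x i = 0 := by
      rw [flipBit_apply, Pi.add_apply, Pi.single_eq_same]
      generalize x i = b
      decide +revert
    simp only [Finset.mem_filter, Finset.mem_univ, true_and, flipBit_flipBit, hi,
      ne_comm (a := h x)]
  have hsplit := Finset.card_filter_add_card_filter_not
    (s := Finset.univ.filter fun x => h x ≠ h (flipBit i x)) fun x => x i = 0
  rwa [Finset.filter_filter, Finset.filter_filter, hflip, ← two_mul] at hsplit

variable {n N d : ℕ} {pos : Fin n ↪ Fin N} {a : EuclideanSpace ℂ (Bits (Ancilla pos))}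

/-- The inputs `x` and `flipBit i x` have the same output distribution, and if `h` differs on them,
then the two success probabilities sum to at most `1`. -/
lemma successProb_le_one_sub_influence (C : Circuit N d) (ha : ‖a‖ = 1) (out : Fin N) {i : Fin n}
    (hi : ∀ x b, outputProb C pos a out (flipBit i x) b = outputProb C pos a out x b)
    (h : Bits (Fin n) → Fin 2) :
    successProb C pos a out h ≤ 1 - influence h i / 2 := by
  set p := outputProb C pos a out
  have hpair (x : Bits (Fin n)) : p x (h x) + p x (h (flipBit i x)) ≤
      2 - if h x ≠ h (flipBit i x) then 1 else 0 := by
    split_ifs with hne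
    · rw [← Finset.sum_pair hne]
      have hle := Finset.sum_le_univ_sum_of_nonneg (s := {h x, h (flipBit i x)})
        (outputProb_nonneg (a := a) C out x)
      linarith [sum_outputProb C ha out x]
    · linarith [outputProb_le_one C ha out x (h x), outputProb_le_one C ha out x (h (flipBit i x))]
  have hflip : ∑ x, p x (h (flipBit i x)) = ∑ x, p x (h x) := by
    rw [← Equiv.sum_comp (flipBit i) fun x => p x (h x)]
    exact Finset.sum_congr rfl fun x _ => (hi x _).symm
  have hsum := Finset.sum_le_sum fun x (_ : x ∈ Finset.univ) => hpair x
  rw [Finset.sum_add_distrib, hflip, Finset.sum_sub_distrib, Finset.sum_boole, Finset.sum_const,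
    Finset.card_univ, Fintype.card_fun, Fintype.card_fin, Fintype.card_fin, nsmul_eq_mul] at hsum
  push_cast at hsum
  rw [successProb, influence, Fintype.card_fin, div_le_iff₀ (by positivity), sub_mul,
    div_right_comm, div_mul_cancel₀ _ (by positivity)]
  linarith

end Influence

section Majority

lemma sixteen_pow_le_mul_centralBinom_sq (m : ℕ) :
    16 ^ m ≤ (4 * m + 1) * m.centralBinom ^ 2 := by
  induction m with
  | zero => simp
  | succ m ih =>
    have h := Nat.succ_mul_centralBinom_succ m
    refine Nat.le_of_mul_le_mul_left ?_ (pow_pos m.succ_pos 2)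
    calc (m + 1) ^ 2 * 16 ^ (m + 1) = 16 * (m + 1) ^ 2 * 16 ^ m := by ring
      _ ≤ 16 * (m + 1) ^ 2 * ((4 * m + 1) * m.centralBinom ^ 2) := by gcongr
      _ = 4 * (4 * (4 * m + 1) * (m + 1) ^ 2) * m.centralBinom ^ 2 := by ring
      _ ≤ 4 * ((4 * (m + 1) + 1) * (2 * m + 1) ^ 2) * m.centralBinom ^ 2 := by
        gcongr ?_ * _
        nlinarith
      _ = (4 * (m + 1) + 1) * (2 * (2 * m + 1) * m.centralBinom) ^ 2 := by ring
      _ = (m + 1) ^ 2 * ((4 * (m + 1) + 1) * (m + 1).centralBinom ^ 2) := by rw [← h]; ring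

lemma four_pow_le_mul_choose_half_sq (n : ℕ) :
    4 ^ (n + 1) ≤ 16 * (n + 1) * n.choose (n / 2) ^ 2 := by
  obtain ⟨m, rfl | rfl⟩ := n.even_or_odd'
  · rw [Nat.mul_div_cancel_left m two_pos, ← Nat.centralBinom_eq_two_mul_choose]
    calc 4 ^ (2 * m + 1) = 4 * 16 ^ m := by rw [pow_succ', pow_mul]; norm_num
      _ ≤ 4 * ((4 * m + 1) * m.centralBinom ^ 2) := by
        gcongr
        exact sixteen_pow_le_mul_centralBinom_sq m
      _ ≤ 16 * (2 * m + 1) * m.centralBinom ^ 2 := by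
        rw [← mul_assoc]
        gcongr ?_ * _
        omega
  · have hhalf : (2 * m + 1) / 2 = m := by omega
    have hcentral : (m + 1).centralBinom = 2 * (2 * m + 1).choose m := by
      rw [Nat.centralBinom_eq_two_mul_choose, Nat.mul_succ, Nat.choose_succ_succ,
        Nat.choose_symm_half, ← two_mul]
    rw [hhalf]
    calc 4 ^ (2 * m + 1 + 1) = 16 ^ (m + 1) := by
          rw [add_assoc, ← Nat.mul_succ, pow_mul]; norm_num
      _ ≤ (4 * (m + 1) + 1) * (2 * (2 * m + 1).choose m) ^ 2 :=
        hcentral ▸ sixteen_pow_le_mul_centralBinom_sq (m + 1)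
      _ = 4 * (4 * (m + 1) + 1) * (2 * m + 1).choose m ^ 2 := by ring
      _ ≤ 16 * (2 * m + 1 + 1) * (2 * m + 1).choose m ^ 2 := by
        gcongr ?_ * _
        omega

variable {n : ℕ}

lemma majority_indicator_one (s : Finset (Fin n)) :
    majority n (indicator s 1) = if n ≤ 2 * s.card then 1 else 0 := by
  have hbit (i : Fin n) :
      (((indicator s 1 : Bits (Fin n)) i : ℕ) : ℝ) = if i ∈ s then 1 else 0 := by
    by_cases hi : i ∈ s <;> simp [hi]
  have hsum : ∑ i, (((indicator s 1 : Bits (Fin n)) i : ℕ) : ℝ) = s.card := by simp [hbit]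
  have hiff : (n : ℝ) / 2 ≤ s.card ↔ n ≤ 2 * s.card := by
    rw [div_le_iff₀' two_pos]
    exact_mod_cast Iff.rfl
  simp only [majority, hsum, hiff]

lemma majority_indicator_one_ne_flipBit {s : Finset (Fin n)} {i : Fin n} (hi : i ∉ s)
    (hs : s.card = (n - 1) / 2) :
    majority n (indicator s 1) ≠ majority n (flipBit i (indicator s 1)) := by
  have hinsert : flipBit i (indicator s 1) = indicator (insert i s : Finset (Fin n)) 1 := by
    funext j
    obtain rfl | hj := eq_or_ne j i
    · simp [flipBit_apply, hi]
    · simp [flipBit_apply, indicator_apply, hj]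
  have hn := i.pos
  rw [hinsert, majority_indicator_one, majority_indicator_one, Finset.card_insert_of_notMem hi,
    if_neg (by omega), if_pos (by omega)]
  exact zero_ne_one

open scoped Fin.CommRing in
lemma two_mul_choose_le_card_pivotal_majority (i : Fin n) :
    2 * (n - 1).choose ((n - 1) / 2) ≤
      (Finset.univ.filter fun x => majority n x ≠ majority n (flipBit i x)).card := by
  have hcard : (Finset.powersetCard ((n - 1) / 2) (Finset.univ.erase i)).card =
      (n - 1).choose ((n - 1) / 2) := by
    rw [Finset.card_powersetCard, Finset.card_erase_of_mem (Finset.mem_univ i), Finset.card_univ,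
      Fintype.card_fin]
  rw [← two_mul_card_pivotal_of_eq_zero, ← hcard]
  gcongr
  refine Finset.card_le_card_of_injOn (fun s => indicator (s : Set (Fin n)) 1) (fun s hs => ?_)
    fun s _ t _ hst => Finset.coe_injective (indicator_one_inj (Fin 2) hst)
  obtain ⟨hsub, hs⟩ := Finset.mem_powersetCard.mp hs
  have his : i ∉ s := fun h => Finset.notMem_erase i _ (hsub h)
  simpa [his] using majority_indicator_one_ne_flipBit his hs

lemma half_sqrt_one_div_le_influence_majority (i : Fin n) :
    1 / 2 * √(1 / n) ≤ influence (majority n) i := by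
  set m := (n - 1).choose ((n - 1) / 2)
  have hn : (0 : ℝ) < n := by exact_mod_cast i.pos
  have hcard : (2 * m : ℝ) ≤
      (Finset.univ.filter fun x => majority n x ≠ majority n (flipBit i x)).card := by
    exact_mod_cast two_mul_choose_le_card_pivotal_majority i
  have hchoose : (4 : ℝ) ^ n ≤ 16 * n * m ^ 2 := by
    have h := four_pow_le_mul_choose_half_sq (n - 1)
    rw [Nat.sub_add_cancel i.pos] at h
    exact_mod_cast h
  rw [influence, Fintype.card_fin, le_div_iff₀ (by positivity)]
  refine le_trans (le_of_sq_le_sq ?_ (by positivity)) hcard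
  rw [mul_pow, mul_pow, Real.sq_sqrt (by positivity), ← pow_mul, mul_comm n 2, pow_mul]
  field_simp
  norm_num
  linarith

end Majority

section PruningThreshold

lemma mul_sq_succ_le_two_pow {k : ℕ} (hk : 30 ≤ k) : 36864 * (k + 1) ^ 2 ≤ 2 ^ k := by
  induction k, hk using Nat.le_induction with
  | base => norm_num
  | succ k hk ih =>
    have hratio : (k + 1 + 1) ^ 2 ≤ 2 * (k + 1) ^ 2 := by nlinarith
    rw [pow_succ 2]
    linarith

lemma mul_sq_le_two_pow_sub_one_div_six {n : ℕ} (hn : 181 ≤ n) :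
    1024 * n ^ 2 ≤ 2 ^ ((n - 1) / 6) := by
  have hdiv : n ≤ 6 * ((n - 1) / 6 + 1) := by omega
  calc 1024 * n ^ 2 ≤ 1024 * (6 * ((n - 1) / 6 + 1)) ^ 2 := by gcongr
    _ = 36864 * ((n - 1) / 6 + 1) ^ 2 := by ring
    _ ≤ 2 ^ ((n - 1) / 6) := mul_sq_succ_le_two_pow (by omega)

lemma two_mul_ceil_mul_three_pow_add_one_le {t : ℝ} (ht : 14 ≤ t) {d : ℕ} (hd : 2 ≤ d) :
    (2 * (⌈2 * t / 3⌉₊ * 3 ^ d) + 1 : ℝ) ≤ t ^ d := by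
  have hceil : (⌈2 * t / 3⌉₊ : ℝ) ≤ 2 * t / 3 + 1 := (Nat.ceil_lt_add_one (by positivity)).le
  have hpow : (1 : ℝ) ≤ 3 ^ d := one_le_pow₀ (by norm_num)
  calc (2 * (⌈2 * t / 3⌉₊ * 3 ^ d) + 1 : ℝ)
      ≤ 2 * ((2 * t / 3 + 1) * 3 ^ d) + 3 ^ d := by gcongr
    _ = (4 * t / 3 + 3) * 3 ^ d := by ring
    _ ≤ (t / 3) ^ 2 * 3 ^ d := by
        gcongr
        nlinarith
    _ ≤ (t / 3) ^ d * 3 ^ d := by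
        gcongr
        linarith
    _ = t ^ d := by rw [← mul_pow, div_mul_cancel₀ _ three_ne_zero]

lemma pow_four_le_two_pow_ceil {s t : ℝ} (hs : 0 ≤ s) (hst : s ≤ 2 ^ (t / 6)) :
    s ^ 4 ≤ 2 ^ ⌈2 * t / 3⌉₊ :=
  calc s ^ 4 ≤ ((2 : ℝ) ^ (t / 6)) ^ 4 := by gcongr
    _ = (2 : ℝ) ^ (2 * t / 3) := by
        rw [← Real.rpow_mul_natCast zero_le_two]
        congr 1
        push_cast
        ring
    _ ≤ (2 : ℝ) ^ (⌈2 * t / 3⌉₊ : ℝ) :=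
        Real.rpow_le_rpow_of_exponent_le one_le_two (Nat.le_ceil _)
    _ = 2 ^ ⌈2 * t / 3⌉₊ := Real.rpow_natCast _ _

variable {n d : ℕ}

lemma four_mul_sqrt_div_le_of_le_two_pow (hn : 1 ≤ n) {k : ℕ}
    (hk : (1024 * d ^ 2 * n ^ 2 : ℝ) ≤ 2 ^ k) :
    4 * d * √(n / 2 ^ k) ≤ 1 / 8 * √(1 / n) := by
  have hn' : (0 : ℝ) < n := by exact_mod_cast hn
  refine le_of_sq_le_sq ?_ (by positivity)
  rw [mul_pow, mul_pow, Real.sq_sqrt (by positivity), mul_pow, Real.sq_sqrt (by positivity),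
    mul_div_assoc', mul_one_div, div_le_div_iff₀ (by positivity) hn']
  linarith

lemma two_pow_mul_sqrt_le_rpow (hn : 1 ≤ n) {t : ℝ}
    (h : 2 * √2 * d * (2 : ℝ) ^ (-t / 6) < 1 / 2 ^ 32 * √(1 / n)) :
    2 ^ 32 * (d * √n) ≤ (2 : ℝ) ^ (t / 6) := by
  have hn' : (0 : ℝ) < n := by exact_mod_cast hn
  have hsqrt : 1 ≤ √(2 : ℝ) := Real.one_le_sqrt.mpr one_le_two
  rw [neg_div, Real.rpow_neg zero_le_two, Real.sqrt_div zero_le_one, Real.sqrt_one,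
    ← div_eq_mul_inv, div_mul_div_comm, one_mul, div_lt_div_iff₀ (by positivity) (by positivity),
    one_mul] at h
  calc 2 ^ 32 * (d * √n) = 1 * d * (2 ^ 32 * √n) := by ring
    _ ≤ 2 * √2 * d * (2 ^ 32 * √n) := by
        gcongr
        linarith
    _ ≤ 2 ^ (t / 6) := h.le

lemma le_of_two_pow_mul_sqrt_le_rpow (hn : 1 ≤ n) (hd : 1 ≤ d) {t : ℝ}
    (h : 2 ^ 32 * (d * √n) ≤ (2 : ℝ) ^ (t / 6)) : 192 ≤ t := by
  have hds : 1 ≤ d * √(n : ℝ) := one_le_mul_of_one_le_of_one_le (by exact_mod_cast hd)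
    (Real.one_le_sqrt.mpr (by exact_mod_cast hn))
  have hpow : (2 : ℝ) ^ (32 : ℝ) ≤ 2 ^ (t / 6) := by
    refine le_trans ?_ h
    rw [Real.rpow_ofNat]
    exact le_mul_of_one_le_right (by positivity) hds
  linarith [(Real.rpow_le_rpow_left_iff one_lt_two).mp hpow]

lemma exists_pruning_threshold (hn : 1 ≤ n) (hd : 1 ≤ d)
    (h : 2 * √2 * d * (2 : ℝ) ^ (-((n : ℝ) ^ (1 / (d : ℝ))) / 6) < 1 / 2 ^ 32 * √(1 / n)) :
    ∃ k, 0 < k ∧ 2 * (k * 3 ^ d) + 1 ≤ n ∧ 4 * d * √(n / 2 ^ k) ≤ 1 / 8 * √(1 / n) := by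
  set t : ℝ := (n : ℝ) ^ (1 / (d : ℝ)) with ht
  have htd : t ^ d = n := by
    rw [ht, one_div, Real.rpow_inv_natCast_pow (by positivity) (by omega)]
  have hbig := two_pow_mul_sqrt_le_rpow hn h
  have ht192 := le_of_two_pow_mul_sqrt_le_rpow hn hd hbig
  rcases hd.eq_or_lt with rfl | hd2
  · have hn192 : 192 ≤ n := by
      rw [pow_one] at htd
      exact_mod_cast htd ▸ ht192
    refine ⟨(n - 1) / 6, by omega, by omega, four_mul_sqrt_div_le_of_le_two_pow hn ?_⟩
    simpa using (Nat.cast_le (α := ℝ)).mpr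
      (mul_sq_le_two_pow_sub_one_div_six ((by norm_num : 181 ≤ 192).trans hn192))
  · refine ⟨⌈2 * t / 3⌉₊, Nat.ceil_pos.mpr (by positivity), ?_,
      four_mul_sqrt_div_le_of_le_two_pow hn ?_⟩
    · exact_mod_cast htd ▸ two_mul_ceil_mul_three_pow_add_one_le (by linarith) hd2
    · refine le_trans ?_ (pow_four_le_two_pow_ceil (by positivity) hbig)
      have hs : √(n : ℝ) ^ 4 = n ^ 2 := by
        rw [show 4 = 2 * 2 from rfl, pow_mul, Real.sq_sqrt (by positivity)]
      rw [mul_pow, mul_pow, hs, ← mul_assoc]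
      gcongr ?_ * ?_ * _
      · norm_num
      · exact pow_le_pow_right₀ (by exact_mod_cast hd) (by norm_num)

end PruningThreshold

end OneDimQAC

theorem mainTheorem8 :
    ∃ c : ℝ, 0 < c ∧
      ∀ (n d : ℕ), 1 ≤ n → 1 ≤ d →
      ∀ (N : ℕ) (pos : Fin n ↪ Fin N)
        (a : EuclideanSpace ℂ (OneDimQAC.Bits (OneDimQAC.Ancilla pos))), ‖a‖ = 1 →
      ∀ (C : OneDimQAC.Circuit N d) (out : Fin N),
        OneDimQAC.successProb C pos a out (OneDimQAC.majority n) ≤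
          1 - c * Real.sqrt (1 / (n : ℝ)) +
            2 * Real.sqrt 2 * (d : ℝ) * (2 : ℝ) ^ (-((n : ℝ) ^ (1 / (d : ℝ))) / 6) := by
  -- The constant is so small that a nontrivial bound forces `192 ≤ n ^ (1 / d)`.
  refine ⟨1 / 2 ^ 32, by positivity, fun n d hn hd N pos a ha C out => ?_⟩
  rcases le_or_gt (1 / 2 ^ 32 * √(1 / (n : ℝ)))
    (2 * √2 * (d : ℝ) * (2 : ℝ) ^ (-((n : ℝ) ^ (1 / (d : ℝ))) / 6)) with htrivial | hsmall
  · linarith [OneDimQAC.successProb_le_one C ha out (OneDimQAC.majority n)]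
  obtain ⟨k, hk, hkn, hloss⟩ := OneDimQAC.exists_pruning_threshold hn hd hsmall
  obtain ⟨i, hi⟩ := C.exists_forall_outputProb_prune_flipBit (a := a) out hk hkn
  have hprune := OneDimQAC.successProb_le_prune C ha out k (OneDimQAC.majority n)
  have hignored :=
    OneDimQAC.successProb_le_one_sub_influence (C.prune pos k) ha out hi (OneDimQAC.majority n)
  have hinfluence := OneDimQAC.half_sqrt_one_div_le_influence_majority i
  have herror : 0 ≤ 2 * √2 * (d : ℝ) * (2 : ℝ) ^ (-((n : ℝ) ^ (1 / (d : ℝ))) / 6) := by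
    positivity
  linarith
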